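/- **Theorem (VC-theorem for thickets).** Let $(X,\mu)$ be a finite probability space (every subset of $X$ is measurable) and let $\mathcal F\subseteq\mathcal P(X)$ be a family of subsets. For $n\ge 0$ let $2^{<n}$ be the set of binary sequences of length less than $n$, which has $2^n-1$ elements. A *tree of height $n$* is a family $\bar x=(x_\sigma)_{\sigma\in 2^{<n}}\in X^{2^n-1}$ of elements of $X$. A sequence $\tau\in\{0,1\}^n$ is *properly labeled* by $A\subseteq X$ in $\bar x$ if for all $m<n$ one has $x_{\tau|_{[m]}}\in A$ if and only if $\tau(m)=1$, where $\tau|_{[m]}=(\tau(0),\dots,\tau(m-1))$. Let the thicket shatter function $\rho_{\mathcal F}(n)$ be the maximum, over all trees $\bar x$ of height $n$, of the number of $\tau\in\{0,1\}^n$ that are properly labeled in $\bar x$ by some element of $\mathcal F$. For a tree $\bar x$ of height $n$ and $S\subseteq X$ put $$\mathrm{test}(\bar x,S)=\frac1n\sum_{i=0}^{n-1}\ \sum_{\tau\in\{0,1\}^i}\Bigl(1_S(x_\tau)\prod_{j=0}^{i-1}\chi_S^{\tau}(x_{\tau|_{[j]}})\Bigr),$$ where $1_S$ is the indicator function of $S$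 and $\chi_S^{\tau}(x_{\tau|_{[j]}})$ is $1$ if ($x_{\tau|_{[j]}}\in S\Leftrightarrow\tau(j)=1$) and $0$ otherwise (for $n=0$, $\mathrm{test}(\bar x,S)=0$). Then for every $n\ge 0$ and every $\epsilon>0$, $$\mu^{2^n-1}\Bigl(\Bigl\{\bar x\in X^{2^n-1}:\ \sup_{S\in\mathcal F}\bigl|\mathrm{test}(\bar x,S)-\mu(S)\bigr|>\epsilon\Bigr\}\Bigr)\ \le\ 8\,\rho_{\mathcal F}(n)\,\exp\Bigl(-\frac{n\epsilon^2}{32}\Bigr),$$ where the supremum over the empty family is $0$. -/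

import Mathlib

open MeasureTheory

noncomputable section

namespace Thicket

/-- The set `2^{<n}` of binary sequences of length less than `n`: a length `i < n` together with
a sequence of that length. It has `2 ^ n - 1` elements. -/
abbrev Node (n : ℕ) : Type := Σ i : Fin n, (Fin i → Bool)

/-- Binary element trees (test trees) of height `n` with labels from `X`. -/
abbrev ElementTree (n : ℕ) (X : Type*) : Type _ := Node n → X

/-- The initial segment `τ|_{[m]}` of a binary sequence `τ` of length `k ≤ n`, for `m < k`,
as a node of `2^{<n}`. -/
def initSeg {n k : ℕ} (hk : k ≤ n) (τ : Fin k → Bool) (m : Fin k) : Node n :=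
  ⟨⟨m, m.isLt.trans_le hk⟩, fun j => τ ⟨j, j.isLt.trans m.isLt⟩⟩

/-- The leaf `τ` of the tree `T` is properly labeled by the set `A`. -/
def ProperlyLabeled {n : ℕ} {X : Type*} (T : ElementTree n X) (τ : Fin n → Bool) (A : Set X) :
    Prop :=
  ∀ m : Fin n, T (initSeg le_rfl τ m) ∈ A ↔ τ m = true

/-- The leaves of `T` that are properly labeled by some element of `F`. -/
def properLeaves {n : ℕ} {X : Type*} (F : Set (Set X)) (T : ElementTree n X) :
    Set (Fin n → Bool) :=
  {τ | ∃ A ∈ F, ProperlyLabeled T τ A}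

/-- The thicket shatter function `ρ_F(n)`: the maximum, over all binary element trees of height `n`,
of the number of leaves properly labeled by elements of `F` (these numbers are at most `2 ^ n`). -/
def thicketShatter {X : Type*} (F : Set (Set X)) (n : ℕ) : ℕ :=
  ⨆ T : ElementTree n X, (properLeaves F T).ncard

open Classical in
/-- The indicator of the condition `y ∈ S ↔ b = 1`; it gives `χ_S^τ(x_σ)` for `y = x_σ` and
`b = τ(|σ|)`. -/
def chi {X : Type*} (S : Set X) (b : Bool) (y : X) : ℝ :=
  if (y ∈ S ↔ b = true) then 1 else 0

/-- `Y_{S,i}(x) = ∑_{τ ∈ 2^i} 1_S(x_τ) ∏_{σ < τ} χ_S^τ(x_σ)`; the proper initial segments `σ` of `τ`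
are indexed by their lengths `j < i`. -/
def query {n : ℕ} {X : Type*} (x : ElementTree n X) (S : Set X) (i : Fin n) : ℝ :=
  ∑ τ : Fin i → Bool,
    S.indicator 1 (x ⟨i, τ⟩) * ∏ j : Fin i, chi S (τ j) (x (initSeg i.isLt.le τ j))

/-- The thicket estimate `test(x, S)` of the measure of `S` (it is `0` for `n = 0`). -/
def test {n : ℕ} {X : Type*} (x : ElementTree n X) (S : Set X) : ℝ :=
  (1 / (n : ℝ)) * ∑ i : Fin n, query x S i

end Thicket

end

/-! The proof bounds an exponential moment and then applies Chernoff. Let `expSup` be the supremum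
over `F` of `exp (l * (total - n * mass))`. Symmetrization is done one level at a time. Besides the
root label `x`, a ghost point `y` is drawn, and by Jensen the factor `exp (-l * mass)` is at most
the mean of `exp (-l * 1_S(y))` (`expSup_succ_le`). Splitting `F` by the answers `a`, `b` at `x`,
`y` leaves the same problem on one subtree, which is independent of `x`.

By induction that subproblem is bounded by a shatter number of the doubly restricted family. This
number is unchanged when `(x, a)` and `(y, b)` are swapped, so the weights `exp (±l)` average to
`cosh l` (`sum_exp_bit_sub_bit_le`). Each level thus costs one `cosh l` and two levels of
shattering, giving `cosh l ^ n * ρ(2n)` (`expect_expSup_le`). Submultiplicativity gives `ρ(2n) ≤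
ρ(n) ^ 2`. The square is absorbed at the end because the stated bound is vacuous unless it is below
1. -/

open MeasureTheory

noncomputable section

namespace Thicket

/-! ### Recursive decomposition of trees -/

variable {X : Type*} {n : ℕ}

/-- The root of a tree of positive height. -/
def root (T : ElementTree (n + 1) X) : X := T ⟨0, Fin.elim0⟩

/-- The subtree of `T` above the node `(b)`. -/
def sub (T : ElementTree (n + 1) X) (b : Bool) : ElementTree n X :=
  fun σ => T ⟨σ.1.succ, Fin.cons (α := fun _ => Bool) b σ.2⟩

/-- The nodes of `2^{<n+1}` are the root and the nodes above its two successors. -/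
def nodeSuccEquiv (n : ℕ) : Option (Bool × Node n) ≃ Node (n + 1) where
  toFun o := o.elim ⟨0, Fin.elim0⟩
    fun q => ⟨q.2.1.succ, Fin.cons (α := fun _ => Bool) q.1 q.2.2⟩
  invFun
    | ⟨⟨0, _⟩, _⟩ => none
    | ⟨⟨i + 1, h⟩, τ⟩ => some (τ 0, ⟨⟨i, Nat.lt_of_succ_lt_succ h⟩, Fin.tail τ⟩)
  left_inv := by
    rintro (_ | ⟨b, ⟨i, hi⟩, τ⟩)
    · rfl
    · simp [Fin.succ]
  right_inv := by
    rintro ⟨⟨_ | i, hi⟩, τ⟩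
    · simp only [Option.elim]
      congr 1
      exact Subsingleton.elim (α := Fin 0 → Bool) _ _
    · simp only [Option.elim, Fin.succ]
      congr 1
      exact Fin.cons_self_tail (α := fun _ => Bool) τ

/-- A tree of height `n + 1` is a root together with two trees of height `n`. -/
def treeSuccEquiv (n : ℕ) (X : Type*) :
    X × ElementTree n X × ElementTree n X ≃ ElementTree (n + 1) X where
  toFun q := fun σ => ((nodeSuccEquiv n).symm σ).elim q.1
    fun r => if r.1 then q.2.1 r.2 else q.2.2 r.2
  invFun T := (root T, sub T true, sub T false)
  left_inv := by
    rintro ⟨x, T₁, T₀⟩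
    have hr : ∀ o, (nodeSuccEquiv n).symm ((nodeSuccEquiv n) o) = o :=
      (nodeSuccEquiv n).symm_apply_apply
    refine Prod.ext ?_ (Prod.ext ?_ ?_)
    · simp only [root]
      rw [show (⟨0, Fin.elim0⟩ : Node (n + 1)) = nodeSuccEquiv n none from rfl, hr]
      rfl
    · funext σ
      simp only [sub]
      rw [show (⟨σ.1.succ, Fin.cons (α := fun _ => Bool) true σ.2⟩ : Node (n + 1))
        = nodeSuccEquiv n (some (true, σ)) from rfl, hr]
      rfl
    · funext σ
      simp only [sub]
      rw [show (⟨σ.1.succ, Fin.cons (α := fun _ => Bool) false σ.2⟩ : Node (n + 1))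
        = nodeSuccEquiv n (some (false, σ)) from rfl, hr]
      rfl
  right_inv := by
    intro T
    funext σ
    obtain ⟨o, rfl⟩ := (nodeSuccEquiv n).surjective σ
    beta_reduce
    rw [Equiv.symm_apply_apply]
    rcases o with _ | ⟨_ | _, σ⟩ <;> rfl

theorem root_treeSuccEquiv (q : X × ElementTree n X × ElementTree n X) :
    root (treeSuccEquiv n X q) = q.1 :=
  congrArg Prod.fst ((treeSuccEquiv n X).symm_apply_apply q)

theorem sub_treeSuccEquiv_true (q : X × ElementTree n X × ElementTree n X) :
    sub (treeSuccEquiv n X q) true = q.2.1 :=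
  congrArg (fun r => r.2.1) ((treeSuccEquiv n X).symm_apply_apply q)

theorem sub_treeSuccEquiv_false (q : X × ElementTree n X × ElementTree n X) :
    sub (treeSuccEquiv n X q) false = q.2.2 :=
  congrArg (fun r => r.2.2) ((treeSuccEquiv n X).symm_apply_apply q)

/-- The members of `F` that contain `x` if `b = true`, and that omit `x` otherwise. -/
def restrict (F : Set (Set X)) (x : X) (b : Bool) : Set (Set X) :=
  {S | S ∈ F ∧ (x ∈ S ↔ b = true)}

theorem restrict_comm (F : Set (Set X)) (x y : X) (a b : Bool) :
    restrict (restrict F x a) y b = restrict (restrict F y b) x a := by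
  ext S
  simp only [restrict, Set.mem_ofPred_eq]
  tauto

/-! ### The thicket shatter function -/

theorem initSeg_cons_zero {k : ℕ} (hk : k + 1 ≤ n + 1) (b : Bool) (τ : Fin k → Bool) :
    initSeg hk (Fin.cons (α := fun _ => Bool) b τ) 0 = ⟨0, Fin.elim0⟩ := by
  simp only [initSeg]
  congr 1
  exact Subsingleton.elim (α := Fin 0 → Bool) _ _

theorem apply_initSeg_cons_succ (T : ElementTree (n + 1) X) {k : ℕ} (hk : k ≤ n) (b : Bool)
    (τ : Fin k → Bool) (m : Fin k) :
    T (initSeg (Nat.succ_le_succ hk) (Fin.cons (α := fun _ => Bool) b τ) m.succ)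
      = sub T b (initSeg hk τ m) := by
  simp only [sub, initSeg]
  congr 2
  funext j
  exact Fin.cases (motive := fun j : Fin (m + 1) => Fin.cons (α := fun _ => Bool) b τ
    ⟨j, j.isLt.trans m.succ.isLt⟩ = Fin.cons (α := fun _ => Bool) b
      (fun j : Fin m => τ ⟨j, j.isLt.trans m.isLt⟩) j) rfl (fun _ => rfl) j

theorem properlyLabeled_cons (T : ElementTree (n + 1) X) (b : Bool) (τ : Fin n → Bool)
    (A : Set X) :
    ProperlyLabeled T (Fin.cons (α := fun _ => Bool) b τ) A ↔
      (root T ∈ A ↔ b = true) ∧ ProperlyLabeled (sub T b) τ A := by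
  have h0 := initSeg_cons_zero (Nat.le_refl (n + 1)) b τ
  have hs := apply_initSeg_cons_succ T le_rfl b τ
  simp only [ProperlyLabeled, Fin.forall_fin_succ, h0, hs, Fin.cons_zero, Fin.cons_succ]
  rfl

theorem properLeaves_succ (F : Set (Set X)) (T : ElementTree (n + 1) X) :
    properLeaves F T =
      Fin.cons (α := fun _ => Bool) true '' properLeaves (restrict F (root T) true) (sub T true) ∪
      Fin.cons (α := fun _ => Bool) false ''
        properLeaves (restrict F (root T) false) (sub T false) := by
  have hc : ∀ (b : Bool) (τ : Fin n → Bool), Fin.cons (α := fun _ => Bool) b τ ∈ properLeaves F T ↔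
      τ ∈ properLeaves (restrict F (root T) b) (sub T b) := by
    intro b τ
    simp only [properLeaves, restrict, Set.mem_ofPred_eq, properlyLabeled_cons, and_assoc]
  ext τ
  induction τ using Fin.consCases with
  | cons b τ =>
    rw [hc]
    cases b <;> simp [Fin.cons_inj]

theorem ncard_properLeaves_succ (F : Set (Set X)) (T : ElementTree (n + 1) X) :
    (properLeaves F T).ncard =
      (properLeaves (restrict F (root T) true) (sub T true)).ncard +
      (properLeaves (restrict F (root T) false) (sub T false)).ncard := by
  rw [properLeaves_succ, Set.ncard_union_eq _ (Set.toFinite _) (Set.toFinite _),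
    Set.ncard_image_of_injective _ (Fin.cons_right_injective _),
    Set.ncard_image_of_injective _ (Fin.cons_right_injective _)]
  rw [Set.disjoint_left]
  rintro _ ⟨σ, -, rfl⟩ ⟨τ, -, h⟩
  simp [Fin.cons_inj] at h

theorem bddAbove_ncard_properLeaves (F : Set (Set X)) (n : ℕ) :
    BddAbove (Set.range fun T : ElementTree n X => (properLeaves F T).ncard) := by
  refine ⟨Nat.card (Fin n → Bool), ?_⟩
  rintro _ ⟨T, rfl⟩
  exact Set.ncard_le_card _

theorem ncard_properLeaves_le (F : Set (Set X)) (T : ElementTree n X) :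
    (properLeaves F T).ncard ≤ thicketShatter F n :=
  le_ciSup (bddAbove_ncard_properLeaves F n) T

theorem exists_ncard_properLeaves_eq [Nonempty X] (F : Set (Set X)) (n : ℕ) :
    ∃ T : ElementTree n X, (properLeaves F T).ncard = thicketShatter F n :=
  Nat.sSup_mem (Set.range_nonempty _) (bddAbove_ncard_properLeaves F n)

theorem thicketShatter_mono [Nonempty X] {F G : Set (Set X)} (h : F ⊆ G) (n : ℕ) :
    thicketShatter F n ≤ thicketShatter G n := by
  obtain ⟨T, hT⟩ := exists_ncard_properLeaves_eq F n
  rw [← hT]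
  refine (Set.ncard_le_ncard ?_ (Set.toFinite _)).trans (ncard_properLeaves_le G T)
  rintro τ ⟨A, hA, hτ⟩
  exact ⟨A, h hA, hτ⟩

theorem one_le_thicketShatter [Nonempty X] {F : Set (Set X)} (hF : F.Nonempty) (n : ℕ) :
    1 ≤ thicketShatter F n := by
  classical
  obtain ⟨A, hA⟩ := hF
  obtain ⟨x⟩ := ‹Nonempty X›
  refine le_trans ?_ (ncard_properLeaves_le F (fun _ : Node n => x))
  rw [Nat.one_le_iff_ne_zero, ← Nat.pos_iff_ne_zero, Set.ncard_pos]
  exact ⟨fun _ => decide (x ∈ A), A, hA, fun m => by simp⟩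

theorem thicketShatter_empty [Nonempty X] (n : ℕ) :
    thicketShatter (∅ : Set (Set X)) n = 0 := by
  simp [thicketShatter, properLeaves]

/-- Graft optimal trees for the two restrictions onto the root `x`. Any `x` will do here, whereas
the reverse inequality needs the root of an optimal tree. -/
theorem thicketShatter_restrict_add_le [Nonempty X] (F : Set (Set X)) (x : X) (n : ℕ) :
    thicketShatter (restrict F x true) n + thicketShatter (restrict F x false) n
      ≤ thicketShatter F (n + 1) := by
  obtain ⟨T₁, h₁⟩ := exists_ncard_properLeaves_eq (restrict F x true) n
  obtain ⟨T₀, h₀⟩ := exists_ncard_properLeaves_eq (restrict F x false) n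
  have h := ncard_properLeaves_le F (treeSuccEquiv n X (x, T₁, T₀))
  rwa [ncard_properLeaves_succ, root_treeSuccEquiv, sub_treeSuccEquiv_true,
    sub_treeSuccEquiv_false, h₁, h₀] at h

theorem exists_thicketShatter_succ_le [Nonempty X] (F : Set (Set X)) (n : ℕ) :
    ∃ x, thicketShatter F (n + 1) ≤
      thicketShatter (restrict F x true) n + thicketShatter (restrict F x false) n := by
  obtain ⟨T, hT⟩ := exists_ncard_properLeaves_eq F (n + 1)
  refine ⟨root T, ?_⟩
  rw [← hT, ncard_properLeaves_succ]
  exact add_le_add (ncard_properLeaves_le _ _) (ncard_properLeaves_le _ _)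

/-- The thicket shatter function is submultiplicative. -/
theorem thicketShatter_add_le [Nonempty X] (F : Set (Set X)) (m n : ℕ) :
    thicketShatter F (m + n) ≤ thicketShatter F m * thicketShatter F n := by
  induction m generalizing F with
  | zero =>
    -- The factor `thicketShatter F 0` is at least 1 only when `F` is nonempty.
    rcases F.eq_empty_or_nonempty with rfl | hF
    · simp [thicketShatter_empty]
    · rw [zero_add]
      exact Nat.le_mul_of_pos_left _ (one_le_thicketShatter hF 0)
  | succ m ih =>
    rw [Nat.add_right_comm]
    obtain ⟨x, hx⟩ := exists_thicketShatter_succ_le F (m + n)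
    have hb : ∀ b, thicketShatter (restrict F x b) (m + n) ≤
        thicketShatter (restrict F x b) m * thicketShatter F n := fun b =>
      (ih _).trans (Nat.mul_le_mul_left _ (thicketShatter_mono (fun _ h => h.1) n))
    calc _ ≤ _ := hx
      _ ≤ _ := add_le_add (hb true) (hb false)
      _ = _ := (add_mul _ _ _).symm
      _ ≤ _ := Nat.mul_le_mul_right _ (thicketShatter_restrict_add_le F x m)

/-! ### The number of positive answers along the path of a set -/

/-- The number of positive answers along the path that `S` takes through `x`. -/
def total (x : ElementTree n X) (S : Set X) : ℝ := ∑ i : Fin n, query x S i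

theorem query_zero (T : ElementTree (n + 1) X) (S : Set X) :
    query T S 0 = S.indicator 1 (root T) := by
  have hsum : query T S 0 = ∑ τ : Fin 0 → Bool, S.indicator (1 : X → ℝ) (T ⟨0, τ⟩) *
      ∏ j : Fin 0, chi S (τ j) (T (initSeg (k := 0) (Nat.zero_le _) τ j)) := rfl
  rw [hsum, Fintype.sum_unique, Fintype.prod_empty, mul_one, root]
  congr 3

-- The factor `chi` at the root kills all sequences whose first bit disagrees with membership of the
-- root in `S`, so only one subtree contributes.
open Classical in
theorem query_succ (T : ElementTree (n + 1) X) (S : Set X) (i : Fin n) :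
    query T S i.succ = query (sub T (decide (root T ∈ S))) S i := by
  have hT : ∀ (b : Bool) (τ : Fin i → Bool),
      S.indicator (1 : X → ℝ) (T ⟨i.succ, Fin.cons (α := fun _ => Bool) b τ⟩) *
        ∏ j : Fin (i + 1), chi S (Fin.cons (α := fun _ => Bool) b τ j)
          (T (initSeg (k := i + 1) i.succ.isLt.le (Fin.cons (α := fun _ => Bool) b τ) j))
      = chi S b (root T) * (S.indicator 1 (sub T b ⟨i, τ⟩) *
        ∏ j : Fin i, chi S (τ j) (sub T b (initSeg i.isLt.le τ j))) := by
    intro b τ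
    have h0 := initSeg_cons_zero (k := i) i.succ.isLt.le b τ
    have hs := apply_initSeg_cons_succ T (k := i) i.isLt.le b τ
    rw [Fin.prod_univ_succ, h0]
    simp only [hs, Fin.cons_zero, Fin.cons_succ, sub, root]
    ring
  have hsum : query T S i.succ = ∑ τ : Fin (i + 1) → Bool,
      S.indicator (1 : X → ℝ) (T ⟨i.succ, τ⟩) *
        ∏ j : Fin (i + 1), chi S (τ j) (T (initSeg (k := i + 1) i.succ.isLt.le τ j)) := rfl
  rw [hsum, ← (Fin.consEquiv fun _ : Fin (i + 1) => Bool).sum_comp, Fintype.sum_prod_type,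
    Fintype.sum_bool]
  have hc : ∀ b, (∑ τ : Fin i → Bool, S.indicator (1 : X → ℝ)
        (T ⟨i.succ, Fin.cons (α := fun _ => Bool) b τ⟩) *
        ∏ j : Fin (i + 1), chi S (Fin.cons (α := fun _ => Bool) b τ j)
          (T (initSeg (k := i + 1) i.succ.isLt.le (Fin.cons (α := fun _ => Bool) b τ) j)))
      = chi S b (root T) * query (sub T b) S i := fun b => by
    simp only [hT, ← Finset.mul_sum, query]
  refine (congrArg₂ (· + ·) (hc true) (hc false)).trans ?_
  by_cases h : root T ∈ S <;> simp [chi, h]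

open Classical in
theorem total_succ (T : ElementTree (n + 1) X) (S : Set X) :
    total T S = S.indicator 1 (root T) + total (sub T (decide (root T ∈ S))) S := by
  simp only [total, Fin.sum_univ_succ, query_zero, query_succ]

/-! ### Expectations over random trees -/

theorem prod_node_succ (p : X → ℝ) (T : ElementTree (n + 1) X) :
    ∏ σ, p (T σ) = p (root T) * ((∏ σ, p (sub T true σ)) * ∏ σ, p (sub T false σ)) := by
  rw [← (nodeSuccEquiv n).prod_comp, Fintype.prod_option, Fintype.prod_prod_type,
    Fintype.prod_bool]
  rfl

/-- The real value of a bit. -/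
def bit (b : Bool) : ℝ := if b then 1 else 0

open Classical in
theorem indicator_eq_bit (S : Set X) (x : X) :
    S.indicator (1 : X → ℝ) x = bit (decide (x ∈ S)) := by
  by_cases h : x ∈ S <;> simp [bit, h]

variable [Fintype X]

/-- The expectation of `f` over trees whose labels are independent with weights `p`. -/
def expect (p : X → ℝ) (f : ElementTree n X → ℝ) : ℝ :=
  ∑ T : ElementTree n X, (∏ σ, p (T σ)) * f T

theorem expect_mono {p : X → ℝ} (hp : ∀ x, 0 ≤ p x) {f g : ElementTree n X → ℝ}
    (h : ∀ T, f T ≤ g T) : expect p f ≤ expect p g :=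
  Finset.sum_le_sum fun T _ =>
    mul_le_mul_of_nonneg_left (h T) (Finset.prod_nonneg fun _ _ => hp _)

theorem expect_sum {ι : Type*} (p : X → ℝ) (s : Finset ι) (f : ι → ElementTree n X → ℝ) :
    expect p (fun T => ∑ i ∈ s, f i T) = ∑ i ∈ s, expect p (f i) := by
  simp only [expect, Finset.mul_sum]
  exact Finset.sum_comm

theorem expect_const_mul (p : X → ℝ) (c : ℝ) (f : ElementTree n X → ℝ) :
    expect p (fun T => c * f T) = c * expect p f := by
  simp only [expect, Finset.mul_sum]
  exact Finset.sum_congr rfl fun T _ => by ring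

theorem expect_add (p : X → ℝ) (f g : ElementTree n X → ℝ) :
    expect p (fun T => f T + g T) = expect p f + expect p g := by
  simp only [expect, mul_add, Finset.sum_add_distrib]

theorem expect_const {p : X → ℝ} (hp : ∑ x, p x = 1) (c : ℝ) :
    expect (n := n) p (fun _ => c) = c := by
  have h : ∑ T : ElementTree n X, ∏ σ, p (T σ) = 1 := by
    rw [← Fintype.prod_sum fun (_ : Node n) x => p x]
    simp [hp]
  rw [expect, ← Finset.sum_mul, h, one_mul]

theorem expect_succ (p : X → ℝ) (f : ElementTree (n + 1) X → ℝ) :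
    expect p f = ∑ x, p x * expect p fun T₁ : ElementTree n X =>
      expect p fun T₀ : ElementTree n X => f (treeSuccEquiv n X (x, T₁, T₀)) := by
  simp only [expect]
  rw [← (treeSuccEquiv n X).sum_comp, Fintype.sum_prod_type]
  refine Finset.sum_congr rfl fun x _ => ?_
  rw [Fintype.sum_prod_type, Finset.mul_sum]
  refine Finset.sum_congr rfl fun T₁ _ => ?_
  simp only [Finset.mul_sum]
  refine Finset.sum_congr rfl fun T₀ _ => ?_
  rw [prod_node_succ, root_treeSuccEquiv, sub_treeSuccEquiv_true, sub_treeSuccEquiv_false]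
  ring

/-- Each of the two subtrees of a random tree is a random tree independent of the root. -/
theorem expect_root_sub {p : X → ℝ} (hp : ∑ x, p x = 1) (b : Bool)
    (g : X → ElementTree n X → ℝ) :
    expect p (fun T => g (root T) (sub T b)) = ∑ x, p x * expect p (g x) := by
  rw [expect_succ]
  refine Finset.sum_congr rfl fun x _ => ?_
  cases b
  · simp only [root_treeSuccEquiv, sub_treeSuccEquiv_false, expect_const hp]
  · simp only [root_treeSuccEquiv, sub_treeSuccEquiv_true, expect_const hp]

/-! ### The exponential moment of the largest deviation -/

/-- The total weight of `S`. -/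
def mass (p : X → ℝ) (S : Set X) : ℝ := ∑ x, p x * S.indicator 1 x

/-- The largest value of `exp (l * (total T S - n * mass p S))` for `S ∈ F`; it is `0` if `F` is
empty. -/
def expSup (p : X → ℝ) (l : ℝ) (F : Set (Set X)) (T : ElementTree n X) : ℝ :=
  ⨆ S : F, Real.exp (l * (total T S - n * mass p S))

theorem expSup_nonneg (p : X → ℝ) (l : ℝ) (F : Set (Set X)) (T : ElementTree n X) :
    0 ≤ expSup p l F T :=
  Real.iSup_nonneg fun _ => (Real.exp_pos _).le

theorem le_expSup (p : X → ℝ) (l : ℝ) {F : Set (Set X)} {S : Set X} (hS : S ∈ F)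
    (T : ElementTree n X) :
    Real.exp (l * (total T S - n * mass p S)) ≤ expSup p l F T :=
  le_ciSup (f := fun S : F => Real.exp (l * (total T S - n * mass p S)))
    (Set.finite_range _).bddAbove ⟨S, hS⟩

/-- Jensen's inequality for `exp`; this is where the ghost point `y` enters. -/
theorem exp_neg_mass_le {p : X → ℝ} (hp : ∀ x, 0 ≤ p x) (hp1 : ∑ x, p x = 1) (l : ℝ)
    (S : Set X) :
    Real.exp (-(l * mass p S)) ≤ ∑ y, p y * Real.exp (-(l * S.indicator 1 y)) := by
  have h := convexOn_exp.map_sum_le (t := Finset.univ) (w := p)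
    (p := fun y => -(l * S.indicator (1 : X → ℝ) y)) (fun x _ => hp x) hp1
    (fun _ _ => Set.mem_univ _)
  simp only [smul_eq_mul] at h
  refine le_of_eq_of_le ?_ h
  congr 1
  rw [mass, Finset.mul_sum, ← Finset.sum_neg_distrib]
  exact Finset.sum_congr rfl fun x _ => by ring

-- For a fixed `S`, the answers `a` at the root and `b` at `y` select one nonnegative term of the
-- double sum. Summing over all answers makes the bound independent of `S`.
open Classical in
theorem expSup_succ_le {p : X → ℝ} (hp : ∀ x, 0 ≤ p x) (hp1 : ∑ x, p x = 1) (l : ℝ)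
    (F : Set (Set X)) (T : ElementTree (n + 1) X) :
    expSup p l F T ≤ ∑ y, p y * ∑ a, ∑ b, Real.exp (l * (bit a - bit b)) *
      expSup p l (restrict (restrict F (root T) a) y b) (sub T a) := by
  have hnn : ∀ y a b, 0 ≤ Real.exp (l * (bit a - bit b)) *
      expSup p l (restrict (restrict F (root T) a) y b) (sub T a) := fun y a b =>
    mul_nonneg (Real.exp_pos _).le (expSup_nonneg _ _ _ _)
  refine Real.iSup_le ?_ (Finset.sum_nonneg fun y _ => mul_nonneg (hp y) <|
    Finset.sum_nonneg fun a _ => Finset.sum_nonneg fun b _ => hnn y a b)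
  rintro ⟨S, hS⟩
  set a := decide (root T ∈ S) with ha
  set g := Real.exp (l * (total (sub T a) S - n * mass p S)) with hg
  have hsplit : Real.exp (l * (total T S - (n + 1 : ℕ) * mass p S)) =
      Real.exp (-(l * mass p S)) * (Real.exp (l * bit a) * g) := by
    rw [total_succ, indicator_eq_bit, ← ha, hg, ← Real.exp_add, ← Real.exp_add]
    congr 1
    push_cast
    ring
  rw [hsplit]
  refine (mul_le_mul_of_nonneg_right (exp_neg_mass_le hp hp1 l S)
    (mul_nonneg (Real.exp_pos _).le (Real.exp_pos _).le)).trans ?_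
  rw [Finset.sum_mul]
  refine Finset.sum_le_sum fun y _ => ?_
  rw [mul_assoc]
  refine mul_le_mul_of_nonneg_left ?_ (hp y)
  have hmem : S ∈ restrict (restrict F (root T) a) y (decide (y ∈ S)) :=
    ⟨⟨hS, by simp [ha]⟩, by simp⟩
  calc Real.exp (-(l * S.indicator 1 y)) * (Real.exp (l * bit a) * g)
      = Real.exp (l * (bit a - bit (decide (y ∈ S)))) * g := by
        rw [indicator_eq_bit, ← mul_assoc, ← Real.exp_add]
        congr 2
        ring
    _ ≤ Real.exp (l * (bit a - bit (decide (y ∈ S)))) *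
          expSup p l (restrict (restrict F (root T) a) y (decide (y ∈ S))) (sub T a) :=
        mul_le_mul_of_nonneg_left (le_expSup p l hmem _) (Real.exp_pos _).le
    _ ≤ ∑ b, Real.exp (l * (bit a - bit b)) *
          expSup p l (restrict (restrict F (root T) a) y b) (sub T a) :=
        Finset.single_le_sum (f := fun b => Real.exp (l * (bit a - bit b)) *
          expSup p l (restrict (restrict F (root T) a) y b) (sub T a))
          (fun b _ => hnn y a b) (Finset.mem_univ _)
    _ ≤ _ := Finset.single_le_sum (f := fun a => ∑ b, Real.exp (l * (bit a - bit b)) *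
          expSup p l (restrict (restrict F (root T) a) y b) (sub T a))
          (fun a _ => Finset.sum_nonneg fun b _ => hnn y a b) (Finset.mem_univ a)

/-- Exchanging the roles of `x` and `y` replaces the weights `exp (± l)` by their mean. -/
theorem sum_exp_bit_sub_bit_le {p : X → ℝ} (hp : ∀ x, 0 ≤ p x) (hp1 : ∑ x, p x = 1) (l R : ℝ)
    (r : Bool → Bool → X → X → ℝ) (hr : ∀ a b x y, 0 ≤ r a b x y)
    (hsymm : ∀ a b x y, r a b x y = r b a y x) (hR : ∀ x y, ∑ a, ∑ b, r a b x y ≤ R) :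
    ∑ y, p y * ∑ a, ∑ b, Real.exp (l * (bit a - bit b)) * ∑ x, p x * r a b x y
      ≤ Real.cosh l * R := by
  set Q : Bool → Bool → ℝ := fun a b => ∑ y, p y * ∑ x, p x * r a b x y with hQ
  have hQ0 : ∀ a b, 0 ≤ Q a b := fun a b => Finset.sum_nonneg fun y _ =>
    mul_nonneg (hp y) (Finset.sum_nonneg fun x _ => mul_nonneg (hp x) (hr _ _ _ _))
  -- The labels `x` and `y` have the same weights, so they may be exchanged.
  have hQs : Q true false = Q false true := by
    simp only [hQ, Finset.mul_sum]
    rw [Finset.sum_comm]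
    refine Finset.sum_congr rfl fun x _ => Finset.sum_congr rfl fun y _ => ?_
    rw [hsymm]
    ring
  have hQR : Q true true + Q true false + (Q false true + Q false false) ≤ R := by
    have h1 : Q true true + Q true false + (Q false true + Q false false)
        = ∑ y, p y * ∑ x, p x * ∑ a, ∑ b, r a b x y := by
      simp only [hQ, Fintype.sum_bool, mul_add, Finset.sum_add_distrib]
      ring
    rw [h1]
    calc _ ≤ ∑ y, p y * ∑ x, p x * R := Finset.sum_le_sum fun y _ =>
          mul_le_mul_of_nonneg_left (Finset.sum_le_sum fun x _ =>
            mul_le_mul_of_nonneg_left (hR x y) (hp x)) (hp y)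
      _ = R := by rw [← Finset.sum_mul, ← Finset.sum_mul, hp1, one_mul, one_mul]
  have hL : ∑ y, p y * ∑ a, ∑ b, Real.exp (l * (bit a - bit b)) * ∑ x, p x * r a b x y
      = Q true true + Real.exp l * Q true false
        + (Real.exp (-l) * Q false true + Q false false) := by
    simp only [hQ, Fintype.sum_bool, mul_add, Finset.sum_add_distrib, bit, if_true,
      Bool.false_eq_true, if_false, sub_self, sub_zero, zero_sub, mul_zero, mul_one, mul_neg,
      Real.exp_zero, one_mul, mul_left_comm (p _) (Real.exp _), ← Finset.mul_sum]
    ring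
  have hc := Real.one_le_cosh l
  rw [hL, ← hQs]
  rw [← hQs] at hQR
  have h2 : Real.exp l * Q true false + Real.exp (-l) * Q true false
      = Real.cosh l * (2 * Q true false) := by
    rw [Real.cosh_eq]
    ring
  have h3 := mul_le_mul_of_nonneg_left hQR (zero_le_one.trans hc)
  have h4 := mul_nonneg (sub_nonneg.2 hc) (add_nonneg (hQ0 true true) (hQ0 false false))
  linarith

theorem expect_expSup_le [Nonempty X] {p : X → ℝ} (hp : ∀ x, 0 ≤ p x) (hp1 : ∑ x, p x = 1)
    (l : ℝ) (F : Set (Set X)) (n : ℕ) :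
    expect (n := n) p (expSup p l F) ≤ Real.cosh l ^ n * thicketShatter F (2 * n) := by
  induction n generalizing F with
  | zero =>
    rw [pow_zero, one_mul]
    refine (expect_mono hp (g := fun _ => (thicketShatter F (2 * 0) : ℝ)) fun T => ?_).trans
      (expect_const hp1 _).le
    refine Real.iSup_le (fun S => ?_) (Nat.cast_nonneg _)
    -- At height 0 the exponential is `exp 0 = 1`.
    simpa [total] using one_le_thicketShatter ⟨S.1, S.2⟩ 0
  | succ n ih =>
    calc expect p (expSup p l F)
        ≤ expect p (fun T : ElementTree (n + 1) X =>
            ∑ y, p y * ∑ a, ∑ b, Real.exp (l * (bit a - bit b)) *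
              expSup p l (restrict (restrict F (root T) a) y b) (sub T a)) :=
          expect_mono hp fun T => expSup_succ_le hp hp1 l F T
      _ = ∑ y, p y * ∑ a, ∑ b, Real.exp (l * (bit a - bit b)) *
            ∑ x, p x * expect (n := n) p (expSup p l (restrict (restrict F x a) y b)) := by
          simp only [expect_sum, expect_const_mul]
          refine Finset.sum_congr rfl fun y _ => congrArg _ <| Finset.sum_congr rfl fun a _ =>
            Finset.sum_congr rfl fun b _ => congrArg _ ?_
          exact expect_root_sub hp1 a fun x => expSup p l (restrict (restrict F x a) y b)
      _ ≤ ∑ y, p y * ∑ a, ∑ b, Real.exp (l * (bit a - bit b)) *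
            ∑ x, p x * (Real.cosh l ^ n *
              thicketShatter (restrict (restrict F x a) y b) (2 * n)) := by
          refine Finset.sum_le_sum fun y _ => mul_le_mul_of_nonneg_left ?_ (hp y)
          refine Finset.sum_le_sum fun a _ => Finset.sum_le_sum fun b _ =>
            mul_le_mul_of_nonneg_left ?_ (Real.exp_pos _).le
          exact Finset.sum_le_sum fun x _ => mul_le_mul_of_nonneg_left (ih _) (hp x)
      _ ≤ Real.cosh l * (Real.cosh l ^ n * thicketShatter F (2 * (n + 1))) := by
          have hc : 0 ≤ Real.cosh l ^ n := (pow_pos (Real.cosh_pos l) n).le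
          refine sum_exp_bit_sub_bit_le hp hp1 l _
            (fun a b x y => Real.cosh l ^ n *
              thicketShatter (restrict (restrict F x a) y b) (2 * n))
            (fun a b x y => mul_nonneg hc (Nat.cast_nonneg _))
            (fun a b x y => by rw [restrict_comm]) fun x y => ?_
          simp only [← Finset.mul_sum]
          refine mul_le_mul_of_nonneg_left ?_ hc
          have h1 := thicketShatter_restrict_add_le (restrict F x true) y (2 * n)
          have h0 := thicketShatter_restrict_add_le (restrict F x false) y (2 * n)
          -- Querying `x` and then `y` uses up two levels of shattering.
          have h := thicketShatter_restrict_add_le F x (2 * n + 1)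
          simp only [Fintype.sum_bool]
          exact_mod_cast (add_le_add h1 h0).trans h
      _ = _ := by ring

/-! ### The deviation inequality -/

theorem measureReal_pi_eq_expect [MeasurableSpace X] [DiscreteMeasurableSpace X] (μ : Measure X)
    [IsProbabilityMeasure μ] (A : Set (ElementTree n X)) :
    (Measure.pi fun _ : Node n => μ).real A
      = expect (fun x => μ.real {x}) (A.indicator 1) := by
  classical
  have hA : A = ((Finset.univ.filter (· ∈ A) : Finset (ElementTree n X)) : Set _) := by simp
  conv_lhs => rw [hA]
  rw [← sum_measureReal_singleton, Finset.sum_filter, expect]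
  refine Finset.sum_congr rfl fun T _ => ?_
  by_cases h : T ∈ A
  · simp [h, Measure.real, Measure.pi_singleton, ENNReal.toReal_prod]
  · simp [h]

theorem measureReal_eq_mass [MeasurableSpace X] [DiscreteMeasurableSpace X] (μ : Measure X)
    [IsProbabilityMeasure μ] (S : Set X) : μ.real S = mass (fun x => μ.real {x}) S := by
  classical
  have hS : S = ((Finset.univ.filter (· ∈ S) : Finset X) : Set X) := by simp
  conv_lhs => rw [hS]
  rw [← sum_measureReal_singleton, Finset.sum_filter, mass]
  exact Finset.sum_congr rfl fun x _ => by by_cases h : x ∈ S <;> simp [h]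

theorem measureReal_deviation_le [MeasurableSpace X] [DiscreteMeasurableSpace X] (μ : Measure X)
    [IsProbabilityMeasure μ] (F : Set (Set X)) (hn : 0 < n) {ε : ℝ} (hε : 0 < ε) :
    (Measure.pi fun _ : Node n => μ).real
        {x : ElementTree n X | ∃ S ∈ F, ε < |test x S - μ.real S|}
      ≤ 2 * (thicketShatter F n : ℝ) ^ 2 * Real.exp (-(n * ε ^ 2 / 2)) := by
  have : Nonempty X := nonempty_of_isProbabilityMeasure μ
  set p : X → ℝ := fun x => μ.real {x} with hp_def
  have hp : ∀ x, 0 ≤ p x := fun x => measureReal_nonneg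
  have hp1 : ∑ x, p x = 1 := by simp [hp_def, sum_measureReal_singleton]
  have hn' : (0 : ℝ) < n := Nat.cast_pos.2 hn
  -- Chernoff with `l = ±ε`, one sign per tail: this minimizes `-|l| * n * ε + n * l ^ 2 / 2`, the
  -- exponent obtained from `cosh l ≤ exp (l ^ 2 / 2)`.
  set c := Real.exp (-(n * ε ^ 2)) with hc
  have hmark : ∀ l : ℝ, ∀ (T : ElementTree n X) (S : Set X), S ∈ F →
      n * ε ^ 2 ≤ l * (total T S - n * mass p S) → 1 ≤ c * expSup p l F T := by
    intro l T S hS h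
    refine le_trans ?_ (mul_le_mul_of_nonneg_left (le_expSup p l hS T) (Real.exp_pos _).le)
    rw [hc, ← Real.exp_add, Real.one_le_exp_iff]
    linarith
  rw [measureReal_pi_eq_expect]
  have hbound : ∀ T : ElementTree n X,
      ({x : ElementTree n X | ∃ S ∈ F, ε < |test x S - μ.real S|}.indicator 1 T : ℝ)
        ≤ c * (expSup p ε F T + expSup p (-ε) F T) := by
    intro T
    have h1 := mul_nonneg (Real.exp_pos (-(n * ε ^ 2))).le (expSup_nonneg p ε F T)
    have h2 := mul_nonneg (Real.exp_pos (-(n * ε ^ 2))).le (expSup_nonneg p (-ε) F T)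
    rw [← hc] at h1 h2
    rw [mul_add]
    by_cases hT : T ∈ {x : ElementTree n X | ∃ S ∈ F, ε < |test x S - μ.real S|}
    · rw [Set.indicator_of_mem hT, Pi.one_apply]
      obtain ⟨S, hS, hd⟩ := hT
      have ht : total T S - n * mass p S = n * (test T S - μ.real S) := by
        rw [measureReal_eq_mass, ← hp_def, test, total]
        field_simp
      rcases lt_abs.1 hd with hd | hd
      · have := hmark ε T S hS (by rw [ht]; nlinarith [mul_pos hn' hε])
        linarith
      · have := hmark (-ε) T S hS (by rw [ht]; nlinarith [mul_pos hn' hε])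
        linarith
    · rw [Set.indicator_of_notMem hT]
      linarith
  have hsub : (thicketShatter F (2 * n) : ℝ) ≤ (thicketShatter F n : ℝ) ^ 2 := by
    rw [two_mul, sq]
    exact_mod_cast thicketShatter_add_le F n n
  have hcosh : Real.cosh ε ^ n ≤ Real.exp (n * ε ^ 2 / 2) := by
    calc Real.cosh ε ^ n ≤ Real.exp (ε ^ 2 / 2) ^ n :=
          pow_le_pow_left₀ (Real.cosh_pos ε).le (Real.cosh_le_exp_half_sq ε) n
      _ = Real.exp (n * ε ^ 2 / 2) := by rw [← Real.exp_nat_mul, mul_div_assoc]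
  have hmgf : ∀ l, Real.cosh l = Real.cosh ε → expect (n := n) p (expSup p l F) ≤
      Real.exp (n * ε ^ 2 / 2) * (thicketShatter F n : ℝ) ^ 2 := by
    intro l hl
    refine (expect_expSup_le hp hp1 l F n).trans ?_
    rw [hl]
    exact mul_le_mul hcosh hsub (Nat.cast_nonneg _) (Real.exp_pos _).le
  refine (expect_mono hp hbound).trans ?_
  rw [expect_const_mul, expect_add]
  refine (mul_le_mul_of_nonneg_left (add_le_add (hmgf ε rfl) (hmgf (-ε) (Real.cosh_neg ε)))
    (Real.exp_pos _).le).trans_eq ?_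
  have : Real.exp (-(n * ε ^ 2 / 2)) = c * Real.exp (n * ε ^ 2 / 2) := by
    rw [hc, ← Real.exp_add]
    congr 1
    ring
  rw [this]
  ring

end Thicket

end

/-! ### From the squared shatter function to the stated bound -/

theorem mainTheorem5 {X : Type*} [Finite X] [MeasurableSpace X] [DiscreteMeasurableSpace X]
    (μ : Measure X) [IsProbabilityMeasure μ] (F : Set (Set X)) (n : ℕ) (ε : ℝ) (hε : 0 < ε) :
    (Measure.pi fun _ : Thicket.Node n => μ).real
        {x : Thicket.ElementTree n X | ε < ⨆ S : F, |Thicket.test x (S : Set X) - μ.real (S : Set X)|}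
      ≤ 8 * (Thicket.thicketShatter F n : ℝ) * Real.exp (-((n : ℝ) * ε ^ 2 / 32)) := by
  have : Fintype X := Fintype.ofFinite X
  have : Nonempty X := nonempty_of_isProbabilityMeasure μ
  rcases F.eq_empty_or_nonempty with rfl | hF
  · simp [Thicket.thicketShatter_empty, hε.le, not_lt_of_ge]
  have hρ : (1 : ℝ) ≤ Thicket.thicketShatter F n := by
    exact_mod_cast Thicket.one_le_thicketShatter hF n
  -- A bound of at least 1 is trivial for a probability; otherwise `8 * ρ * E < 1`, which pays for
  -- the extra factor `ρ` below and excludes `n = 0`.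
  rcases le_or_gt 1 (8 * (Thicket.thicketShatter F n : ℝ) * Real.exp (-((n : ℝ) * ε ^ 2 / 32)))
    with hA | hA
  · exact measureReal_le_one.trans hA
  have hn : 0 < n := by
    rcases Nat.eq_zero_or_pos n with rfl | hn
    · simp only [Nat.cast_zero, zero_mul, zero_div, neg_zero, Real.exp_zero] at hA
      linarith
    · exact hn
  have : Nonempty F := hF.to_subtype
  refine (measureReal_mono ?_).trans
    ((Thicket.measureReal_deviation_le μ F hn hε).trans ?_)
  · intro x hx
    obtain ⟨S, hS⟩ := exists_lt_of_lt_ciSup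
      (show ε < ⨆ S : F, |Thicket.test x S - μ.real S| from hx)
    exact ⟨S, S.2, hS⟩
  set E := Real.exp (-((n : ℝ) * ε ^ 2 / 32)) with hE
  set ρ : ℝ := (Thicket.thicketShatter F n : ℝ)
  have hE0 : 0 < E := Real.exp_pos _
  -- The left side equals `E ^ 16`; two factors of `E` suffice, one to match each `ρ`.
  have hexp : Real.exp (-(n * ε ^ 2 / 2)) ≤ E ^ 2 := by
    rw [hE, ← Real.exp_nat_mul, Real.exp_le_exp]
    have : 0 ≤ (n : ℝ) * ε ^ 2 := by positivity
    push_cast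
    linarith
  calc 2 * ρ ^ 2 * Real.exp (-(n * ε ^ 2 / 2)) ≤ 2 * ρ ^ 2 * E ^ 2 :=
        mul_le_mul_of_nonneg_left hexp (by positivity)
    _ = ρ * E / 4 * (8 * ρ * E) := by ring
    _ ≤ ρ * E / 4 * 1 := mul_le_mul_of_nonneg_left hA.le (by positivity)
    _ ≤ 8 * ρ * E := by
        have : 0 ≤ ρ * E := by positivity
        linarith
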